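/- **Theorem (forward invariance under multiple constraints and discontinuous inputs).** Consider the control-affine system $\dot x = f(x) + g(x)u$, $u\in\mathcal U$, where $f:\mathbb R^n\to\mathbb R^n$ and $g:\mathbb R^n\to\mathbb R^{n\times m}$ are locally Lipschitz and $\mathcal U=\{u\in\mathbb R^m : A_u u\le b_u\}$, with $A_u\in\mathbb R^{p\times m}$ and $b_u\in\mathbb R^p$, is a compact polytope with non-empty interior. Let $h_1,\dots,h_{N_h}:\mathbb R^n\to\mathbb R$ be continuously differentiable, let $\alpha_1,\dots,\alpha_{N_h}:\mathbb R\to\mathbb R$ be extended class-$\mathcal K$ functions (continuous, strictly increasing, $\alpha_i(0)=0$), and put $$S_i=\{x : h_i(x)\le 0\},\qquad S_I=\bigcap_{i=1}^{N_h}S_i,\qquad I(x)=\{i : h_i(x)=0\}.$$ For $x\in\mathbb R^n$ let $$\widehat K(x)=\{u\in\mathbb R^m : L_gh_i(x)u\le-\alpha_i(h_i(x))-L_fh_i(x)\ \text{for } i=1,\dots,N_h,\ \text{and } A_uu\le b_u\},$$ where $L_fh_i=\nabla h_i\, f$ and $L_gh_i=\nabla h_i\, g$. For a number $\hat\gamma\ge0$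 let $$\widehat K_{\hat\gamma}(x)=\{u\in\widehat K(x) : \operatorname{dist}(u,\mathbb R^m\setminus\widehat K(x))\ge\hat\gamma\},\qquad \widehat G_{\hat\gamma}(x)=\{f(x)+g(x)u : u\in\widehat K_{\hat\gamma}(x)\},$$ where the distance to the empty set is $+\infty$. For a set $S\subseteq\mathbb R^n$ and $x\in S$, let $T_S(x)$ be the Clarke tangent cone: $v\in T_S(x)$ if and only if for all sequences $y_k\to x$ in $S$ and $t_k\to0$ with $t_k>0$ there are $w_k\to v$ with $y_k+t_kw_k\in S$ for all $k$. Suppose that for every $x\in S_I$ and all distinct $i,j\in I(x)$ the pair $(S_i,S_j)$ satisfies the transversality condition $T_{S_i}(x)-T_{S_j}(x)=\mathbb R^n$. Let $\widehat\Omega\subseteq\mathbb R^n$ be any set (for instance, the set of all $x$ with $\widehat K_{\hat\gamma}(x)\neq\emptyset$) and let $0<\tau\le\infty$. Let $x:[0,\tau)\to\mathbb R^n$ be a trajectory of $\dot x\in\widehat G_{\hat\gamma}(x)$ under a Lebesgue measurable control $u:[0,\tau)\to\mathbb R^m$; that is, $x$ is absolutely continuous on every $[0,T]$ with $T<\tau$,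 and for almost every $t\in[0,\tau)$ we have $\dot x(t)=f(x(t))+g(x(t))u(t)\in\widehat G_{\hat\gamma}(x(t))$. Suppose that $x(0)\in\operatorname{int}(S_I\cap\widehat\Omega)$, and let $[0,T(x_0))\subseteq[0,\tau)$ be the maximal interval such that $x(t)\in\operatorname{int}(\widehat\Omega)$ for all $t\in[0,T(x_0))$. Then $x(t)\in S_I$ for all $t\in[0,T(x_0))$. -/

import Mathlib

open Set Filter Topology MeasureTheory
open scoped ENNReal Matrix

namespace CBF

/-- Extended class-`𝒦` function on the whole line. -/
structure IsExtendedClassK (α : ℝ → ℝ) : Prop where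
  continuous : Continuous α
  strictMono : StrictMono α
  map_zero : α 0 = 0

/-- The zero-sublevel set `{x | h x ≤ 0}`. -/
def safeSet {n : ℕ} (h : EuclideanSpace ℝ (Fin n) → ℝ) : Set (EuclideanSpace ℝ (Fin n)) :=
  {x | h x ≤ 0}

/-- The composed set `S_I`, the intersection of all the sets `S_i = {h_i ≤ 0}`. -/
def composedSet {n N : ℕ} (h : Fin N → EuclideanSpace ℝ (Fin n) → ℝ) :
    Set (EuclideanSpace ℝ (Fin n)) :=
  ⋂ i, safeSet (h i)

/-- The set `I(x)` of indices of the constraints that are active at `x`. -/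
def activeSet {n N : ℕ} (h : Fin N → EuclideanSpace ℝ (Fin n) → ℝ)
    (x : EuclideanSpace ℝ (Fin n)) : Set (Fin N) :=
  {i | h i x = 0}

/-- The Clarke tangent cone of `S` at a point `x ∈ S`: the vectors `v` such that for all sequences
`y k → x` in `S` and `t k → 0` with `t k > 0` there is a sequence `w k → v` with
`y k + t k • w k ∈ S` for all `k`. -/
def clarkeTangentCone {E : Type*} [NormedAddCommGroup E] [NormedSpace ℝ E]
    (S : Set E) (x : E) : Set E :=
  {v | ∀ (y : ℕ → E) (t : ℕ → ℝ), (∀ k, y k ∈ S) → Tendsto y atTop (𝓝 x) →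
    (∀ k, 0 < t k) → Tendsto t atTop (𝓝 0) →
    ∃ w : ℕ → E, Tendsto w atTop (𝓝 v) ∧ ∀ k, y k + t k • w k ∈ S}

/-- The transversality condition for the pair `(S₁, S₂)` at `x`: the difference of the two Clarke
tangent cones is the whole space. -/
def Transversal {E : Type*} [NormedAddCommGroup E] [NormedSpace ℝ E]
    (S₁ S₂ : Set E) (x : E) : Prop :=
  ∀ z : E, ∃ v₁ ∈ clarkeTangentCone S₁ x, ∃ v₂ ∈ clarkeTangentCone S₂ x, z = v₁ - v₂

/-- The polytope `{u | A u ≤ b}` of admissible inputs (componentwise inequality). -/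
def inputPolytope {m p : ℕ} (A : Matrix (Fin p) (Fin m) ℝ) (b : Fin p → ℝ) :
    Set (EuclideanSpace ℝ (Fin m)) :=
  {u | ∀ k, (A *ᵥ u.ofLp) k ≤ b k}

/-- The Lie derivative `L_f h (x) = ∇h(x) f(x)`. -/
noncomputable def lieF {n : ℕ} (f : EuclideanSpace ℝ (Fin n) → EuclideanSpace ℝ (Fin n))
    (h : EuclideanSpace ℝ (Fin n) → ℝ) (x : EuclideanSpace ℝ (Fin n)) : ℝ :=
  fderiv ℝ h x (f x)

/-- The row `L_g h (x) = ∇h(x) g(x)`, as a linear functional on the input space. The values of `g`,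
`n × m` matrices, are regarded as linear maps `ℝᵐ → ℝⁿ`. -/
noncomputable def lieG {n m : ℕ}
    (g : EuclideanSpace ℝ (Fin n) → EuclideanSpace ℝ (Fin m) →L[ℝ] EuclideanSpace ℝ (Fin n))
    (h : EuclideanSpace ℝ (Fin n) → ℝ) (x : EuclideanSpace ℝ (Fin n)) :
    EuclideanSpace ℝ (Fin m) →L[ℝ] ℝ :=
  (fderiv ℝ h x).comp (g x)

/-- The set-valued map `K̂`: the inputs that satisfy every row
`L_g h_i(x) u ≤ -α_i(h_i(x)) - L_f h_i(x)` and every row of `A u ≤ b`. -/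
def Khat {n m p N : ℕ}
    (f : EuclideanSpace ℝ (Fin n) → EuclideanSpace ℝ (Fin n))
    (g : EuclideanSpace ℝ (Fin n) → EuclideanSpace ℝ (Fin m) →L[ℝ] EuclideanSpace ℝ (Fin n))
    (A : Matrix (Fin p) (Fin m) ℝ) (b : Fin p → ℝ)
    (h : Fin N → EuclideanSpace ℝ (Fin n) → ℝ) (α : Fin N → ℝ → ℝ)
    (x : EuclideanSpace ℝ (Fin n)) : Set (EuclideanSpace ℝ (Fin m)) :=
  {u | (∀ i, lieG g (h i) x u ≤ -α i (h i x) - lieF f (h i) x) ∧ u ∈ inputPolytope A b}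

/-- The `γ`-contraction of a set: its points at distance at least `γ` from its complement
(the distance to the empty set being `∞`). -/
def contraction {E : Type*} [PseudoEMetricSpace E] (γ : ℝ) (K : Set E) : Set E :=
  {u ∈ K | ENNReal.ofReal γ ≤ Metric.infEDist u Kᶜ}

/-- The right-hand side `Ĝ_γ` of the differential inclusion. -/
def Ghat {n m p N : ℕ}
    (f : EuclideanSpace ℝ (Fin n) → EuclideanSpace ℝ (Fin n))
    (g : EuclideanSpace ℝ (Fin n) → EuclideanSpace ℝ (Fin m) →L[ℝ] EuclideanSpace ℝ (Fin n))
    (A : Matrix (Fin p) (Fin m) ℝ) (b : Fin p → ℝ)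
    (h : Fin N → EuclideanSpace ℝ (Fin n) → ℝ) (α : Fin N → ℝ → ℝ) (γ : ℝ)
    (x : EuclideanSpace ℝ (Fin n)) : Set (EuclideanSpace ℝ (Fin n)) :=
  {v | ∃ u ∈ contraction γ (Khat f g A b h α x), v = f x + g x u}

/-- The real points of the interval `[0, τ)`, where `τ = ∞` is allowed. -/
def timeInterval (τ : EReal) : Set ℝ :=
  {t | 0 ≤ t ∧ (t : EReal) < τ}

/-- `x` is, on `[0, τ)`, a (locally absolutely continuous, Carathéodory) trajectory of the
differential inclusion `ẋ ∈ G(x)`, driven by the Lebesgue measurable input `u` through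
`ẋ = f(x) + g(x) u`. The values of `x` and `u` outside `[0, τ)` play no role. -/
structure IsTrajectory {n m : ℕ}
    (f : EuclideanSpace ℝ (Fin n) → EuclideanSpace ℝ (Fin n))
    (g : EuclideanSpace ℝ (Fin n) → EuclideanSpace ℝ (Fin m) →L[ℝ] EuclideanSpace ℝ (Fin n))
    (G : EuclideanSpace ℝ (Fin n) → Set (EuclideanSpace ℝ (Fin n))) (τ : EReal)
    (x : ℝ → EuclideanSpace ℝ (Fin n)) (u : ℝ → EuclideanSpace ℝ (Fin m)) : Prop where
  absolutelyContinuous : ∀ T ∈ timeInterval τ, AbsolutelyContinuousOnInterval x 0 T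
  measurable_input : AEMeasurable u (volume.restrict (timeInterval τ))
  dynamics : ∀ᵐ t ∂(volume.restrict (timeInterval τ)), HasDerivAt x (f (x t) + g (x t) (u t)) t
  inclusion : ∀ᵐ t ∂(volume.restrict (timeInterval τ)), f (x t) + g (x t) (u t) ∈ G (x t)

/-- The right end point `T` of the (possibly empty) maximal interval `[0, T)`, inside the interval
of definition `[0, τ)`, on which `x(t)` lies in the interior of `Ω`. -/
noncomputable def stayTime {n : ℕ} (Ω : Set (EuclideanSpace ℝ (Fin n))) (τ : EReal)
    (x : ℝ → EuclideanSpace ℝ (Fin n)) : EReal :=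
  sSup {T : EReal | T ≤ τ ∧ ∀ t ∈ timeInterval T, x t ∈ interior Ω}

/-- The supremum is attained: `x(t)` lies in the interior of `Ω` on all of `[0, stayTime)`. -/
theorem mem_interior_of_mem_stayTime {n : ℕ} {Ω : Set (EuclideanSpace ℝ (Fin n))} {τ : EReal}
    {x : ℝ → EuclideanSpace ℝ (Fin n)} {t : ℝ} (ht : t ∈ timeInterval (stayTime Ω τ x)) :
    x t ∈ interior Ω := by
  obtain ⟨T, hT, htT⟩ := lt_sSup_iff.mp ht.2
  exact hT.2 t ⟨ht.1, htT⟩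

end CBF

/-! The constraints decouple. Along the trajectory put `φ = h i ∘ x`. The `i`-th row of `Khat` is
imposed at every state, also outside the safe set, so `φ' ≤ -α i (φ)` at almost every time. Since `α
i` is positive on positive numbers, `φ' ≤ 0` wherever `φ > 0`. Absolute continuity makes `φ` the
integral of its derivative, so null sets of times, and hence jumps of the input, do no harm. If `φ`
were positive at some time, integrating from the last earlier time with `φ ≤ 0` would give a
contradiction. -/

/-- The composition of a Lipschitz function with an absolutely continuous one is absolutely
continuous. -/
theorem LipschitzOnWith.comp_absolutelyContinuousOnInterval {X Y : Type*} [PseudoMetricSpace X]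
    [PseudoMetricSpace Y] {F : X → Y} {K : NNReal} {s : Set X} (hF : LipschitzOnWith K F s)
    {x : ℝ → X} {a b : ℝ} (hx : AbsolutelyContinuousOnInterval x a b)
    (hmaps : MapsTo x (uIcc a b) s) :
    AbsolutelyContinuousOnInterval (F ∘ x) a b := by
  rw [absolutelyContinuousOnInterval_iff] at hx ⊢
  intro ε hε
  -- Dividing by `K + 1` rather than `K` covers the case `K = 0`.
  obtain ⟨δ, hδ, H⟩ := hx (ε / (K + 1)) (by positivity)
  refine ⟨δ, hδ, fun E hE hlen => ?_⟩
  have hsum := H E hE hlen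
  have hle : ∑ i ∈ Finset.range E.1, dist ((F ∘ x) (E.2 i).1) ((F ∘ x) (E.2 i).2) ≤
      K * ∑ i ∈ Finset.range E.1, dist (x (E.2 i).1) (x (E.2 i).2) := by
    rw [Finset.mul_sum]
    refine Finset.sum_le_sum fun i hi => ?_
    exact hF.dist_le_mul _ (hmaps (hE.1 i hi).1) _ (hmaps (hE.1 i hi).2)
  have hnonneg : 0 ≤ ∑ i ∈ Finset.range E.1, dist (x (E.2 i).1) (x (E.2 i).2) :=
    Finset.sum_nonneg fun _ _ => dist_nonneg
  rw [lt_div_iff₀ (by positivity)] at hsum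
  nlinarith

/-- A continuously differentiable function of an absolutely continuous curve is absolutely
continuous. -/
theorem ContDiff.comp_absolutelyContinuousOnInterval {E F : Type*} [NormedAddCommGroup E]
    [NormedSpace ℝ E] [NormedAddCommGroup F] [NormedSpace ℝ F] {h : E → F} (hh : ContDiff ℝ 1 h)
    {x : ℝ → E} {a b : ℝ} (hx : AbsolutelyContinuousOnInterval x a b) :
    AbsolutelyContinuousOnInterval (h ∘ x) a b := by
  -- The curve has compact image, on which the locally Lipschitz `h` has a single Lipschitz
  -- constant.
  have hcompact : IsCompact (x '' uIcc a b) := isCompact_uIcc.image_of_continuousOn hx.continuousOn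
  obtain ⟨K, hK⟩ := LocallyLipschitzOn.exists_lipschitzOnWith_of_compact hcompact
    (hh.locallyLipschitz.locallyLipschitzOn)
  exact hK.comp_absolutelyContinuousOnInterval hx (mapsTo_image _ _)

/-- An absolutely continuous function with a.e. nonpositive derivative does not increase. -/
theorem AbsolutelyContinuousOnInterval.le_of_ae_deriv_nonpos {φ : ℝ → ℝ} {a b : ℝ} (hab : a ≤ b)
    (hφ : AbsolutelyContinuousOnInterval φ a b)
    (hderiv : ∀ᵐ t, t ∈ Ioc a b → deriv φ t ≤ 0) : φ b ≤ φ a := by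
  have hint : ∫ t in a..b, deriv φ t ≤ 0 := by
    rw [intervalIntegral.integral_of_le hab]
    exact integral_nonpos_of_ae ((ae_restrict_iff' measurableSet_Ioc).mpr hderiv)
  rw [hφ.integral_deriv_eq_sub] at hint
  linarith

/-- An absolutely continuous function that starts nonpositive, and whose derivative is a.e.
nonpositive where the function is positive, stays nonpositive. -/
theorem AbsolutelyContinuousOnInterval.nonpos_of_ae_deriv_nonpos {φ : ℝ → ℝ} {a b : ℝ}
    (hab : a ≤ b) (hφ : AbsolutelyContinuousOnInterval φ a b) (ha : φ a ≤ 0)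
    (hderiv : ∀ᵐ t, t ∈ Ioc a b → 0 < φ t → deriv φ t ≤ 0) : φ b ≤ 0 := by
  have hcont : ContinuousOn φ (Icc a b) := uIcc_of_le hab ▸ hφ.continuousOn
  have hcompact : IsCompact (Icc a b ∩ φ ⁻¹' Iic 0) :=
    isCompact_Icc.of_isClosed_subset
      (hcont.preimage_isClosed_of_isClosed isClosed_Icc isClosed_Iic) inter_subset_left
  -- `s` is the last time in `[a, b]` with `φ ≤ 0`; by maximality `φ > 0` on `(s, b]`, so `φ` does
  -- not increase there.
  obtain ⟨s, hs, hmax⟩ := hcompact.exists_isGreatest ⟨a, left_mem_Icc.mpr hab, ha⟩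
  refine le_trans ?_ hs.2
  refine (hφ.mono ?_).le_of_ae_deriv_nonpos hs.1.2 ?_
  · rw [uIcc_of_le hab, uIcc_of_le hs.1.2]
    exact Icc_subset_Icc_left hs.1.1
  · filter_upwards [hderiv] with t ht hts
    refine ht ⟨hs.1.1.trans_lt hts.1, hts.2⟩ ?_
    by_contra hneg
    exact hts.1.not_ge (hmax ⟨⟨hs.1.1.trans hts.1.le, hts.2⟩, not_lt.mp hneg⟩)

/-- Every velocity in `Ĝ_γ(x)` satisfies the barrier inequality of each constraint. -/
theorem CBF.fderiv_le_of_mem_Ghat {n m p N : ℕ}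
    {f : EuclideanSpace ℝ (Fin n) → EuclideanSpace ℝ (Fin n)}
    {g : EuclideanSpace ℝ (Fin n) → EuclideanSpace ℝ (Fin m) →L[ℝ] EuclideanSpace ℝ (Fin n)}
    {A : Matrix (Fin p) (Fin m) ℝ} {b : Fin p → ℝ}
    {h : Fin N → EuclideanSpace ℝ (Fin n) → ℝ} {α : Fin N → ℝ → ℝ} {γ : ℝ}
    {x v : EuclideanSpace ℝ (Fin n)} (hv : v ∈ CBF.Ghat f g A b h α γ x) (i : Fin N) :
    fderiv ℝ (h i) x v ≤ -α i (h i x) := by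
  obtain ⟨w, hw, rfl⟩ := hv
  have hrow := hw.1.1 i
  simp only [CBF.lieG, CBF.lieF, ContinuousLinearMap.comp_apply] at hrow
  rw [map_add]
  linarith

theorem mainTheorem9 {n m p N : ℕ}
    (f : EuclideanSpace ℝ (Fin n) → EuclideanSpace ℝ (Fin n))
    (g : EuclideanSpace ℝ (Fin n) → EuclideanSpace ℝ (Fin m) →L[ℝ] EuclideanSpace ℝ (Fin n))
    (hf : LocallyLipschitz f) (hg : LocallyLipschitz g)
    (A : Matrix (Fin p) (Fin m) ℝ) (b : Fin p → ℝ)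
    (hU_compact : IsCompact (CBF.inputPolytope A b))
    (hU_interior : (interior (CBF.inputPolytope A b)).Nonempty)
    (h : Fin N → EuclideanSpace ℝ (Fin n) → ℝ) (hh : ∀ i, ContDiff ℝ 1 (h i))
    (α : Fin N → ℝ → ℝ) (hα : ∀ i, CBF.IsExtendedClassK (α i))
    (γ : ℝ) (hγ : 0 ≤ γ)
    (htransversal : ∀ x ∈ CBF.composedSet h,
      ∀ i ∈ CBF.activeSet h x, ∀ j ∈ CBF.activeSet h x, i ≠ j →
        CBF.Transversal (CBF.safeSet (h i)) (CBF.safeSet (h j)) x)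
    (Ω : Set (EuclideanSpace ℝ (Fin n))) (τ : EReal)
    (x : ℝ → EuclideanSpace ℝ (Fin n)) (u : ℝ → EuclideanSpace ℝ (Fin m))
    (hx : CBF.IsTrajectory f g (CBF.Ghat f g A b h α γ) τ x u)
    (hx0 : x 0 ∈ interior (CBF.composedSet h ∩ Ω)) :
    ∀ t ∈ CBF.timeInterval (CBF.stayTime Ω τ x), x t ∈ CBF.composedSet h := by
  intro t ht
  have htτ : t ∈ CBF.timeInterval τ := ⟨ht.1, ht.2.trans_le (sSup_le fun _ hT => hT.1)⟩
  refine mem_iInter.mpr fun i => ?_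
  have hAC : AbsolutelyContinuousOnInterval (h i ∘ x) 0 t :=
    (hh i).comp_absolutelyContinuousOnInterval (hx.absolutelyContinuous t htτ)
  have hsub : Ioc 0 t ⊆ CBF.timeInterval τ := fun s hs =>
    ⟨hs.1.le, (EReal.coe_le_coe_iff.mpr hs.2).trans_lt htτ.2⟩
  refine hAC.nonpos_of_ae_deriv_nonpos ht.1 (mem_iInter.mp (interior_subset hx0).1 i) ?_
  rw [← ae_restrict_iff' measurableSet_Ioc]
  filter_upwards [ae_restrict_of_ae_restrict_of_subset hsub hx.dynamics,
    ae_restrict_of_ae_restrict_of_subset hsub hx.inclusion] with s hdyn hincl hpos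
  have hd := ((hh i).differentiable one_ne_zero (x s)).hasFDerivAt.comp_hasDerivAt s hdyn
  rw [hd.deriv]
  -- Here the constraint is violated, so the barrier bound `-α i (h i (x s))` is negative.
  have hα_pos : 0 < α i (h i (x s)) := (hα i).map_zero ▸ (hα i).strictMono hpos
  linarith [CBF.fderiv_le_of_mem_Ghat hincl i]
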